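/- Let $(M,M_0)$ be a relative finite CW-complex (with $M$ Hausdorff), let $X$ be a topological space with a non-degenerate base-point $*$, and let $k,t\ge 1$ be integers. Let $F(M,k)\subset M^k$ be the space of $k$-tuples of pairwise distinct points of $M$, on which the symmetric group $\Sigma_k$ acts by permuting the entries, and let $$\xi_{M,k}:\ \mathbb{R}^k\longrightarrow F(M,k)\times_{\Sigma_k}\mathbb{R}^k\longrightarrow F(M,k)/\Sigma_k$$ be the canonical vector bundle. Assume that $\xi_{M,k}$ has finite order, that is, some Whitney power $\xi_{M,k}^{\oplus s}$ with $s\ge 1$ is trivial, and let $o(\xi_{M,k})$ be the least such $s$. For $k\ge 1$ let $C_k(M,M_0;X)$ be the quotient of $\coprod_{0\le j\le k}F(M,j)\times X^j$ by the equivalence relation generated by $(m_1,\dots,m_j;x_1,\dots,x_j)\sim(m_{\sigma(1)},\dots,m_{\sigma(j)};x_{\sigma(1)},\dots,x_{\sigma(j)})$ for $\sigma\in\Sigma_j$, and $(m_1,\dots,m_j;x_1,\dots,x_j)\sim(m_1,\dots,m_{j-1};x_1,\dots,x_{j-1})$ if $m_j\in M_0$ or $x_j=*$. Let $D_k(M,M_0;X)=C_k(M,M_0;X)/C_{k-1}(M,M_0;X)$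 be the $k$-adic construction, the quotient in which the image of $C_{k-1}(M,M_0;X)$ is collapsed to the base-point. Write $\Sigma^nY=S^n\wedge Y$ for the $n$-fold reduced suspension of a pointed space $Y$. Then there is a (pointed) homotopy equivalence $$\Sigma^{k\,t\,o(\xi_{M,k})}D_k(M,M_0;X)\longrightarrow D_k\bigl(M,M_0;\Sigma^{t\,o(\xi_{M,k})}X\bigr).$$ -/

import Mathlib

/-! ### Pointed spaces, quotients and suspensions -/

/-- The quotient space `Y / A` in which the subset `A` is collapsed to one point. -/
def Collapse {Y : Type*} (A : Set Y) : Type _ :=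
  Quot fun a b : Y => a ∈ A ∧ b ∈ A

instance {Y : Type*} [TopologicalSpace Y] (A : Set Y) : TopologicalSpace (Collapse A) :=
  inferInstanceAs (TopologicalSpace (Quot fun a b : Y => a ∈ A ∧ b ∈ A))

/-- The projection `Y → Y / A`. -/
def Collapse.mk {Y : Type*} (A : Set Y) (y : Y) : Collapse A := Quot.mk _ y

/-- The smash product `Y ∧ Z = (Y × Z) / (Y × {z₀} ∪ {y₀} × Z)`. -/
def Smash {Y Z : Type*} (y₀ : Y) (z₀ : Z) : Type _ :=
  Collapse {p : Y × Z | p.1 = y₀ ∨ p.2 = z₀}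

instance {Y Z : Type*} [TopologicalSpace Y] [TopologicalSpace Z] (y₀ : Y) (z₀ : Z) :
    TopologicalSpace (Smash y₀ z₀) :=
  inferInstanceAs (TopologicalSpace (Collapse {p : Y × Z | p.1 = y₀ ∨ p.2 = z₀}))

/-- The base point of a smash product. -/
def Smash.base {Y Z : Type*} (y₀ : Y) (z₀ : Z) : Smash y₀ z₀ := Collapse.mk _ (y₀, z₀)

/-- The sphere `S^n`, as the one-point compactification of `ℝ^n`, with base point `∞`. -/
abbrev Sph (n : ℕ) : Type := OnePoint (Fin n → ℝ)

/-- The `n`-fold (reduced) suspension `Σ^n X = S^n ∧ X` of the pointed space `(X, x₀)`. -/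
abbrev Susp (n : ℕ) {X : Type*} (x₀ : X) : Type _ :=
  Smash (OnePoint.infty : Sph n) x₀

/-- The base point of `Σ^n X`. -/
abbrev Susp.base (n : ℕ) {X : Type*} (x₀ : X) : Susp n x₀ :=
  Smash.base (OnePoint.infty : Sph n) x₀

/-- The base point `x₀` is non-degenerate: the inclusion `{x₀} → X` is a cofibration, that is, it
has the homotopy extension property. -/
def IsNondegenerate.{u} {X : Type u} [TopologicalSpace X] (x₀ : X) : Prop :=
  ∀ (Y : Type u) [TopologicalSpace Y] (f : C(X, Y)) (γ : C(unitInterval, Y)), γ 0 = f x₀ →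
    ∃ H : C(X × unitInterval, Y), (∀ x, H (x, 0) = f x) ∧ ∀ s, H (x₀, s) = γ s

/-- The pointed spaces `(Y, y₀)` and `(Z, z₀)` are homotopy equivalent through pointed maps and
pointed homotopies. -/
def PointedHomotopyEquivalent {Y Z : Type*} [TopologicalSpace Y] [TopologicalSpace Z]
    (y₀ : Y) (z₀ : Z) : Prop :=
  ∃ (f : C(Y, Z)) (g : C(Z, Y)), f y₀ = z₀ ∧ g z₀ = y₀ ∧
    (g.comp f).HomotopicRel (ContinuousMap.id Y) {y₀} ∧
    (f.comp g).HomotopicRel (ContinuousMap.id Z) {z₀}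

/-! ### Whitney powers and the order of a real vector bundle

A vector bundle over `B` with model fibre `F` is given as in Mathlib: fibres `E b`, `b : B`, which
are real vector spaces, and a topology on `Bundle.TotalSpace F E`. -/

section Bundles

variable {B : Type*} (F : Type*) (E : B → Type*)

/-- The fibres of the `t`-fold Whitney sum `E^{⊕ t}`. -/
abbrev WhitneyPower (t : ℕ) (b : B) : Type _ := Fin t → E b

/-- The total space of `E^{⊕ t}` is the `t`-fold fibre product of the total space of `E`
over `B`. -/
instance WhitneyPower.topologicalSpace [TopologicalSpace B]
    [TopologicalSpace (Bundle.TotalSpace F E)] (t : ℕ) :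
    TopologicalSpace (Bundle.TotalSpace (Fin t → F) (WhitneyPower E t)) :=
  TopologicalSpace.induced
    (fun z => ((z.proj, fun i => ⟨z.proj, z.2 i⟩) : B × (Fin t → Bundle.TotalSpace F E)))
    inferInstance

/-- The bundle `E` is trivial: it is isomorphic, as a vector bundle over `B`, to a product bundle
`B × ℝ^n`. -/
def IsTrivialBundle [TopologicalSpace B] [TopologicalSpace (Bundle.TotalSpace F E)]
    [∀ b, AddCommGroup (E b)] [∀ b, Module ℝ (E b)] : Prop :=
  ∃ (n : ℕ) (Φ : Bundle.TotalSpace F E ≃ₜ B × (Fin n → ℝ)),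
    (∀ z, (Φ z).1 = z.proj) ∧
    ∀ b, IsLinearMap ℝ fun v : E b => (Φ ⟨b, v⟩).2

/-- The set of positive integers `t` such that `E^{⊕ t}` is trivial. -/
def trivialPowers [TopologicalSpace B] [TopologicalSpace (Bundle.TotalSpace F E)]
    [∀ b, AddCommGroup (E b)] [∀ b, Module ℝ (E b)] : Set ℕ :=
  {t | 0 < t ∧ IsTrivialBundle (Fin t → F) (WhitneyPower E t)}

/-- The bundle has finite order: some Whitney power `E^{⊕ t}`, `t ≥ 1`, is trivial. -/
def HasFiniteOrder [TopologicalSpace B] [TopologicalSpace (Bundle.TotalSpace F E)]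
    [∀ b, AddCommGroup (E b)] [∀ b, Module ℝ (E b)] : Prop :=
  (trivialPowers F E).Nonempty

/-- The order of a bundle of finite order: the least `t ≥ 1` such that `E^{⊕ t}` is trivial. -/
noncomputable def bundleOrder [TopologicalSpace B] [TopologicalSpace (Bundle.TotalSpace F E)]
    [∀ b, AddCommGroup (E b)] [∀ b, Module ℝ (E b)] : ℕ :=
  sInf (trivialPowers F E)

end Bundles

/-! ### Configuration spaces and their canonical vector bundles -/

/-- The ordered configuration space `F(M, k)` of `k` distinct points of `M`. -/
abbrev Conf (M : Type*) (k : ℕ) : Type _ := {x : Fin k → M // Function.Injective x}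

/-- The action of a permutation on a configuration by permuting the points. -/
def Conf.perm {M : Type*} {k : ℕ} (x : Conf M k) (σ : Equiv.Perm (Fin k)) : Conf M k :=
  ⟨fun i => x.1 (σ i), x.2.comp σ.injective⟩

/-- The configuration of the first `k` points. -/
def Conf.init {M : Type*} {k : ℕ} (x : Conf M (k + 1)) : Conf M k :=
  ⟨fun i => x.1 i.castSucc, x.2.comp (Fin.castSucc_injective k)⟩

/-- Two configurations are equivalent if they differ by a permutation. -/
instance confSetoid (M : Type*) (k : ℕ) : Setoid (Conf M k) where
  r x y := ∃ σ, y = x.perm σ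
  iseqv :=
    ⟨fun _ => ⟨1, rfl⟩,
     fun {x _} ⟨σ, h⟩ => ⟨σ⁻¹, by subst h; ext i; simp [Conf.perm]⟩,
     fun {x _ _} ⟨σ, h⟩ ⟨τ, h'⟩ => ⟨σ * τ, by subst h h'; ext i; simp [Conf.perm]⟩⟩

/-- The unordered configuration space `F(M, k) / Σ_k`. -/
abbrev UConf (M : Type*) (k : ℕ) : Type _ := Quotient (confSetoid M k)

/-- The diagonal action of `Σ_k` on `F(M, k) × ℝ^k`, permuting points and coordinates. -/
instance twistSetoid (M : Type*) (k : ℕ) : Setoid (Conf M k × (Fin k → ℝ)) where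
  r p q := ∃ σ : Equiv.Perm (Fin k), q.1 = p.1.perm σ ∧ q.2 = fun i => p.2 (σ i)
  iseqv :=
    ⟨fun _ => ⟨1, rfl, rfl⟩,
     fun {p q} ⟨σ, h, h'⟩ => ⟨σ⁻¹, by rw [h]; ext i; simp [Conf.perm], by rw [h']; ext i; simp⟩,
     fun {p q r} ⟨σ, h, h'⟩ ⟨τ, g, g'⟩ =>
      ⟨σ * τ, by rw [g, h]; ext i; simp [Conf.perm], by rw [g', h']; ext i; simp⟩⟩

/-- The total space `F(M, k) ×_{Σ_k} ℝ^k` of the bundle `ξ_{M,k}`. -/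
abbrev ConfTwist (M : Type*) (k : ℕ) : Type _ := Quotient (twistSetoid M k)

/-- The projection of `ξ_{M,k}`. -/
def ConfTwist.proj {M : Type*} {k : ℕ} : ConfTwist M k → UConf M k :=
  Quotient.map Prod.fst fun _ _ ⟨σ, h, _⟩ => ⟨σ, h⟩

/-- The fibre of `ξ_{M,k}` over an unordered configuration. -/
def ConfFiber (M : Type*) (k : ℕ) (b : UConf M k) : Type _ :=
  {e : ConfTwist M k // e.proj = b}

/-- An ordering `x` of an unordered configuration `b` identifies `ℝ^k` with the fibre of `ξ_{M,k}`
over `b`, by `v ↦ [x, v]`. -/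
noncomputable def ConfFiber.equiv {M : Type*} {k : ℕ} {b : UConf M k} (x : Conf M k)
    (hx : (Quotient.mk _ x : UConf M k) = b) : (Fin k → ℝ) ≃ ConfFiber M k b :=
  Equiv.ofBijective (fun v => ⟨Quotient.mk _ (x, v), hx⟩) <| by
    refine ⟨fun v w h => ?_, ?_⟩
    · obtain ⟨σ, h₁, h₂⟩ := Quotient.exact (congrArg Subtype.val h)
      have hσ : ∀ i, σ i = i := fun i => (x.2 (congrFun (congrArg Subtype.val h₁) i)).symm
      ext i
      have := congrFun h₂ i
      simp only [hσ] at this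
      exact this.symm
    · rintro ⟨e, he⟩
      subst hx
      induction e using Quotient.inductionOn with
      | h p =>
        obtain ⟨σ, h⟩ := Quotient.exact he
        exact ⟨fun i => p.2 (σ i), Subtype.ext (Quotient.sound (Setoid.symm ⟨σ, h, rfl⟩))⟩

/-- The vector space structure of a fibre of `ξ_{M,k}`, transported from `ℝ^k` by means of some
ordering; by `ConfFiber.isLinearMap_equiv` it does not depend on the ordering. -/
noncomputable instance (M : Type*) (k : ℕ) (b : UConf M k) : AddCommGroup (ConfFiber M k b) :=
  (ConfFiber.equiv b.out b.out_eq).symm.addCommGroup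

noncomputable instance (M : Type*) (k : ℕ) (b : UConf M k) : Module ℝ (ConfFiber M k b) :=
  (ConfFiber.equiv b.out b.out_eq).symm.module ℝ

theorem ConfFiber.isLinearMap_equiv {M : Type*} {k : ℕ} {b : UConf M k} (x : Conf M k)
    (hx : (Quotient.mk _ x : UConf M k) = b) : IsLinearMap ℝ (ConfFiber.equiv x hx) := by
  obtain ⟨σ, hσ⟩ : ∃ σ, x = Conf.perm b.out σ := Quotient.exact (b.out_eq.trans hx.symm)
  have key : ∀ v : Fin k → ℝ, ConfFiber.equiv x hx v =
      ConfFiber.equiv b.out b.out_eq (fun i => v (σ⁻¹ i)) := fun v =>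
    Subtype.ext (Quotient.sound (Setoid.symm ⟨σ, hσ, by ext i; simp⟩))
  constructor
  · intro v w
    rw [key, key, key]
    refine (ConfFiber.equiv b.out b.out_eq).symm.injective ?_
    rw [Equiv.symm_apply_apply, Equiv.add_def]
    simp only [Equiv.symm_symm, Equiv.symm_apply_apply]
    rfl
  · intro c v
    rw [key, key]
    refine (ConfFiber.equiv b.out b.out_eq).symm.injective ?_
    rw [Equiv.symm_apply_apply, Equiv.smul_def]
    simp only [Equiv.symm_symm, Equiv.symm_apply_apply]
    rfl

/-- The topology of the total space of `ξ_{M,k}` is the one of `F(M, k) ×_{Σ_k} ℝ^k`, under the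
evident bijection. -/
instance (M : Type*) [TopologicalSpace M] (k : ℕ) :
    TopologicalSpace (Bundle.TotalSpace (Fin k → ℝ) (ConfFiber M k)) :=
  TopologicalSpace.induced (fun z => (z.2.1 : ConfTwist M k)) inferInstance

/-- The canonical vector bundle `ξ_{M,k}` has finite order. -/
def ConfBundleHasFiniteOrder (M : Type*) [TopologicalSpace M] (k : ℕ) : Prop :=
  HasFiniteOrder (Fin k → ℝ) (ConfFiber M k)

/-- The order `o(ξ_{M,k})` of the canonical vector bundle over `F(M, k) / Σ_k`. -/
noncomputable def confBundleOrder (M : Type*) [TopologicalSpace M] (k : ℕ) : ℕ :=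
  bundleOrder (Fin k → ℝ) (ConfFiber M k)

/-! ### Labelled configuration spaces and the `k`-adic construction -/

/-- The disjoint union over `j ≤ k` of the spaces `F(M, j) × X^j` of configurations with labels
in `X`. -/
abbrev LabelledConf (M X : Type*) (k : ℕ) : Type _ :=
  Σ j : Fin (k + 1), Conf M j × (Fin j → X)

/-- The identifications in the labelled configuration space: labelled points may be permuted, and
a point may be removed if it lies in `M₀` or if its label is the base point. -/
inductive LabelledConf.Step {M X : Type*} (M₀ : Set M) (x₀ : X) (k : ℕ) :
    LabelledConf M X k → LabelledConf M X k → Prop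
  | perm (j : Fin (k + 1)) (x : Conf M j) (a : Fin j → X) (σ : Equiv.Perm (Fin j)) :
      Step M₀ x₀ k ⟨j, x, a⟩ ⟨j, x.perm σ, fun i => a (σ i)⟩
  | drop (j : ℕ) (hj : j + 1 < k + 1) (x : Conf M (j + 1)) (a : Fin (j + 1) → X)
      (h : x.1 (Fin.last j) ∈ M₀ ∨ a (Fin.last j) = x₀) :
      Step M₀ x₀ k ⟨⟨j + 1, hj⟩, x, a⟩
        ⟨⟨j, Nat.lt_of_succ_lt hj⟩, x.init, fun i => a i.castSucc⟩

/-- The `k`-th filtration `C_k(M, M₀; X)` of the space of configurations in `(M, M₀)` with labels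
in `X`, as a quotient of the disjoint union over `j ≤ k` of the spaces `F(M, j) × X^j`. -/
def LabelFiltration {M X : Type*} (M₀ : Set M) (x₀ : X) (k : ℕ) : Type _ :=
  Quot (LabelledConf.Step M₀ x₀ k)

instance {M X : Type*} [TopologicalSpace M] [TopologicalSpace X] (M₀ : Set M) (x₀ : X) (k : ℕ) :
    TopologicalSpace (LabelFiltration M₀ x₀ k) :=
  inferInstanceAs (TopologicalSpace (Quot (LabelledConf.Step M₀ x₀ k)))

/-- The image of `C_{k-1}(M, M₀; X)` in `C_k(M, M₀; X)`: the classes which are represented by a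
labelled configuration of fewer than `k` points. -/
def LabelFiltration.lower {M X : Type*} (M₀ : Set M) (x₀ : X) (k : ℕ) :
    Set (LabelFiltration M₀ x₀ k) :=
  {c | ∃ p : LabelledConf M X k, (p.1 : ℕ) < k ∧ Quot.mk _ p = c}

/-- The `k`-adic construction `D_k(M, M₀; X) = C_k(M, M₀; X) / C_{k-1}(M, M₀; X)`, `k ≥ 1`. -/
abbrev AdicConstruction {M X : Type*} (M₀ : Set M) (x₀ : X) (k : ℕ) : Type _ :=
  Collapse (LabelFiltration.lower M₀ x₀ k)

/-- The base point of `D_k(M, M₀; X)`, the class of the empty configuration. -/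
def AdicConstruction.base {M X : Type*} (M₀ : Set M) (x₀ : X) (k : ℕ) :
    AdicConstruction M₀ x₀ k :=
  Collapse.mk _ (Quot.mk _ ⟨0, ⟨Fin.elim0, fun i => i.elim0⟩, Fin.elim0⟩)

/-! Write `V = ℝ^(t·o)` and `W = ℝ^(k·t·o)`, where `o` is the order of the bundle, and write `S^V`,
`S^W` for their one-point compactifications. Pulled back to the ordered configuration space, a
trivialization of the `t·o`-th Whitney power is a continuous family of isomorphisms `V^k ≃ W`,
invariant under simultaneous permutation of points and vectors. Both `S^W ∧ D_k(X)` and `D_k(S^V ∧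
X)` receive `F(M,k) × (S^V)^k × X^k`: for the first, project `(S^V)^k` to the compactification of
`V^k` and apply the isomorphism over the configuration; for the second, pair each sphere coordinate
with its label. The points of `S^W ∧ D_k(X)` are then matched with those of `D_k(S^V ∧ X)`.

The difficulty is topological. The map `S^W ∧ D_k(X) → D_k(S^V ∧ X)` is continuous
(`ConfTrivialization.exists_continuous_lift`), because only compact factors have to be carried past
quotient maps. The obvious inverse need not be, since a power of the quotient map `S^V × X → S^V ∧
X` need not be a quotient map. The homotopy inverse therefore first contracts neighbourhoods of the
base points of `S^V` and `X` (`BaseContraction`). This makes it constant wherever the choice of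
representatives in `S^V ∧ X` could be discontinuous (`BaseContraction.rep_mem_or_continuousAt`). The
same contractions, run in time, are the homotopies from the identities to both composites. -/

open Filter Topology

/-! ### One-point compactifications of normed spaces -/

namespace OnePoint

/-- In a proper space every compact set lies in a closed ball about `0`, and such balls are compact.
Continuity at `∞` thereby becomes a norm estimate. -/
theorem tendsto_infty_iff_norm {α E : Type*} [NormedAddCommGroup E] [ProperSpace E]
    {l : Filter α} {g : α → OnePoint E} :
    Tendsto g l (𝓝 ∞) ↔ ∀ R : ℝ, ∀ᶠ z in l, ∀ w : E, g z = w → R < ‖w‖ := by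
  refine ⟨fun h R => ?_, fun h => ?_⟩
  · have hb := (hasBasis_nhds_infty (X := E)).mem_of_mem
      (i := Metric.closedBall (0 : E) R)
      ⟨Metric.isClosed_closedBall, isCompact_closedBall _ _⟩
    filter_upwards [h hb] with z hz w hw
    rw [Set.mem_preimage, hw] at hz
    simpa using hz
  · rw [(hasBasis_nhds_infty (X := E)).tendsto_right_iff]
    rintro s ⟨-, hs⟩
    obtain ⟨R, hR⟩ := hs.isBounded.subset_closedBall (0 : E)
    filter_upwards [h R] with z hz
    induction hg : g z using OnePoint.rec with
    | infty => simp
    | coe w =>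
      refine Or.inl ⟨w, fun hw => ?_, rfl⟩
      have := hR hw
      rw [mem_closedBall_zero_iff] at this
      exact absurd (hz w hg) this.not_gt

theorem eventually_infty_lt_norm {E : Type*} [NormedAddCommGroup E] [ProperSpace E] (R : ℝ) :
    ∀ᶠ y : OnePoint E in 𝓝 ∞, ∀ w : E, y = w → R < ‖w‖ :=
  tendsto_infty_iff_norm.1 tendsto_id R

/-- A continuous family of linear isomorphisms acts continuously on the one-point
compactifications. -/
theorem continuous_map_family {B E E' : Type*} [TopologicalSpace B]
    [NormedAddCommGroup E] [NormedSpace ℝ E] [FiniteDimensional ℝ E]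
    [NormedAddCommGroup E'] [NormedSpace ℝ E'] [FiniteDimensional ℝ E'] (G : B → E ≃L[ℝ] E')
    (hG : Continuous fun p : B × E => G p.1 p.2)
    (hG' : Continuous fun p : B × E' => (G p.1).symm p.2) :
    Continuous fun p : B × OnePoint E => OnePoint.map (G p.1) p.2 := by
  have : ProperSpace E := FiniteDimensional.proper_real E
  have : ProperSpace E' := FiniteDimensional.proper_real E'
  rw [continuous_iff_continuousAt]
  rintro ⟨b, w⟩
  induction w using OnePoint.rec with
  | coe v =>
    have hemb : IsOpenEmbedding (Prod.map id (↑) : B × E → B × OnePoint E) :=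
      IsOpenEmbedding.id.prodMap isOpenEmbedding_coe
    exact (hemb.continuousAt_iff (x := (b, v))).1 (continuous_coe.comp hG).continuousAt
  | infty =>
    have hop : Continuous fun b => ((G b).symm : E' →L[ℝ] E) :=
      continuous_clm_apply.2 fun y => hG'.comp (by fun_prop : Continuous fun b : B => (b, y))
    -- Near `b` the inverses have norm below `C`, so `‖v‖ ≤ C * ‖G b' v‖`, and `‖v‖ > C * R` forces
    -- `‖G b' v‖ > R`.
    set C := ‖((G b).symm : E' →L[ℝ] E)‖ + 1 with hC
    have hC0 : 0 < C := by positivity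
    have hbd : ∀ᶠ b' in 𝓝 b, ‖((G b').symm : E' →L[ℝ] E)‖ < C :=
      hop.norm.continuousAt.eventually_lt continuousAt_const (by simp [hC])
    refine tendsto_infty_iff_norm.2 fun R => ?_
    rw [nhds_prod_eq]
    filter_upwards [hbd.prod_mk (eventually_infty_lt_norm (C * R))] with p hp u hu
    obtain ⟨b', y⟩ := p
    induction y using OnePoint.rec with
    | infty => exact absurd hu (infty_ne_coe u)
    | coe v =>
      have hv := hp.2 v rfl
      have hu' : G b' v = u := coe_injective hu
      have h1 : ‖v‖ ≤ ‖((G b').symm : E' →L[ℝ] E)‖ * ‖u‖ := by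
        have := ((G b').symm : E' →L[ℝ] E).le_opNorm u
        rwa [← hu', ContinuousLinearEquiv.coe_coe, ContinuousLinearEquiv.symm_apply_apply,
          hu'] at this
      have h2 : ‖((G b').symm : E' →L[ℝ] E)‖ * ‖u‖ ≤ C * ‖u‖ :=
        mul_le_mul_of_nonneg_right hp.1.le (norm_nonneg _)
      exact lt_of_mul_lt_mul_left (hv.trans_le (h1.trans h2)) hC0.le

section OfPi

variable {ι V : Type*}

open Classical in
/-- The projection from a product of one-point compactifications to the one-point
compactification of the product, i.e. to the smash product. -/
noncomputable def ofPi (w : ι → OnePoint V) : OnePoint (ι → V) :=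
  if h : ∃ v : ι → V, (fun i => (v i : OnePoint V)) = w then (h.choose : OnePoint (ι → V)) else ∞

@[simp]
theorem ofPi_coe (v : ι → V) : ofPi (fun i => (v i : OnePoint V)) = v := by
  have h : ∃ v' : ι → V, (fun i => (v' i : OnePoint V)) = fun i => (v i : OnePoint V) := ⟨v, rfl⟩
  rw [ofPi, dif_pos h]
  congr 1
  ext i
  exact coe_injective (congrFun h.choose_spec i)

theorem ofPi_eq_infty {w : ι → OnePoint V} (h : ∃ i, w i = ∞) : ofPi w = ∞ := by
  rw [ofPi, dif_neg]
  rintro ⟨v, rfl⟩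
  obtain ⟨i, hi⟩ := h
  exact coe_ne_infty _ hi

theorem exists_eq_infty_or_exists_coe (w : ι → OnePoint V) :
    (∃ i, w i = ∞) ∨ ∃ v : ι → V, w = fun i => (v i : OnePoint V) := by
  by_cases h : ∃ i, w i = ∞
  · exact Or.inl h
  · simp only [not_exists, ← ne_eq, ne_infty_iff_exists] at h
    choose v hv using h
    exact Or.inr ⟨v, funext fun i => (hv i).symm⟩

theorem ofPi_perm (w : ι → OnePoint V) (σ : ι ≃ ι) :
    ofPi (fun i => w (σ i)) = OnePoint.map (fun v : ι → V => fun i => v (σ i)) (ofPi w) := by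
  obtain ⟨i, hi⟩ | ⟨v, rfl⟩ := exists_eq_infty_or_exists_coe w
  · rw [ofPi_eq_infty ⟨i, hi⟩, ofPi_eq_infty ⟨σ.symm i, by simpa⟩]
    rfl
  · rw [ofPi_coe (fun i => v (σ i)), ofPi_coe]
    rfl

/-- The sup norm dominates each coordinate, so one coordinate tending to `∞` suffices. The tuples of
finite points form an open copy of `ι → V`. -/
theorem continuous_ofPi [Fintype ι] [NormedAddCommGroup V] [ProperSpace V] :
    Continuous (ofPi : (ι → OnePoint V) → OnePoint (ι → V)) := by
  rw [continuous_iff_continuousAt]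
  intro w
  obtain ⟨i, hi⟩ | ⟨v, rfl⟩ := exists_eq_infty_or_exists_coe w
  · rw [ContinuousAt, ofPi_eq_infty ⟨i, hi⟩, tendsto_infty_iff_norm]
    intro R
    have hw : Tendsto (fun w' : ι → OnePoint V => w' i) (𝓝 w) (𝓝 ∞) := by
      rw [← hi]
      exact (continuous_apply i).continuousAt
    filter_upwards [tendsto_infty_iff_norm.1 hw R] with w' hw' v hv
    obtain h | ⟨v', rfl⟩ := exists_eq_infty_or_exists_coe w'
    · rw [ofPi_eq_infty h] at hv
      exact absurd hv (infty_ne_coe v)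
    · rw [ofPi_coe] at hv
      rw [coe_injective hv] at hw'
      exact (hw' _ rfl).trans_le (norm_le_pi_norm v i)
  · have hemb : IsOpenEmbedding (Pi.map fun _ => (↑) : (ι → V) → ι → OnePoint V) :=
      IsOpenEmbedding.piMap fun _ => isOpenEmbedding_coe
    refine (hemb.continuousAt_iff (x := v)).1 ?_
    have : ofPi ∘ (Pi.map fun _ => (↑) : (ι → V) → ι → OnePoint V) = (↑) := funext ofPi_coe
    rw [this]
    exact continuous_coe.continuousAt

theorem ofPi_surjective [Nonempty ι] :
    Function.Surjective (ofPi : (ι → OnePoint V) → OnePoint (ι → V)) := by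
  intro y
  induction y using OnePoint.rec with
  | infty => exact ⟨fun _ => ∞, ofPi_eq_infty ⟨Classical.arbitrary ι, rfl⟩⟩
  | coe v => exact ⟨_, ofPi_coe v⟩

end OfPi

section Stretch

variable {V : Type*} [NormedAddCommGroup V] [NormedSpace ℝ V]

open Classical in
/-- The radial homotopy of the one-point compactification of `V` from the identity to a map which
sends the complement of the open unit ball to `∞`. -/
noncomputable def stretch (s : ℝ) (w : OnePoint V) : OnePoint V :=
  OnePoint.elim w ∞ fun v => if s * ‖v‖ < 1 then ((1 - s * ‖v‖)⁻¹ • v : V) else ∞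

theorem stretch_coe_of_lt {s : ℝ} {v : V} (h : s * ‖v‖ < 1) :
    stretch s (v : OnePoint V) = ((1 - s * ‖v‖)⁻¹ • v : V) := if_pos h

theorem stretch_coe_of_le {s : ℝ} {v : V} (h : 1 ≤ s * ‖v‖) :
    stretch s (v : OnePoint V) = ∞ := if_neg h.not_gt

@[simp]
theorem stretch_zero (w : OnePoint V) : stretch 0 w = w := by
  induction w using OnePoint.rec with
  | infty => rfl
  | coe v => rw [stretch_coe_of_lt (by simp)]; simp

theorem continuous_stretch [ProperSpace V] :
    Continuous fun p : unitInterval × OnePoint V => stretch (p.1 : ℝ) p.2 := by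
  rw [continuous_iff_continuousAt]
  rintro ⟨s, w⟩
  induction w using OnePoint.rec with
  | infty =>
    refine tendsto_infty_iff_norm.2 fun R => ?_
    have hw : Tendsto (fun p : unitInterval × OnePoint V => p.2) (𝓝 (s, ∞)) (𝓝 ∞) :=
      continuous_snd.continuousAt
    filter_upwards [tendsto_infty_iff_norm.1 hw R] with p hp u hu
    obtain ⟨s', w'⟩ := p
    induction w' using OnePoint.rec with
    | infty => exact absurd hu (infty_ne_coe u)
    | coe v =>
      have hv := hp v rfl
      rcases lt_or_ge ((s' : ℝ) * ‖v‖) 1 with h | h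
      · rw [stretch_coe_of_lt h] at hu
        rw [← coe_injective hu, norm_smul, norm_inv, Real.norm_of_nonneg (by linarith)]
        have h0 : 0 ≤ (s' : ℝ) * ‖v‖ := mul_nonneg s'.2.1 (norm_nonneg _)
        have h1 : 1 ≤ (1 - (s' : ℝ) * ‖v‖)⁻¹ := one_le_inv_iff₀.2 ⟨by linarith, by linarith⟩
        exact hv.trans_le (le_mul_of_one_le_left (norm_nonneg _) h1)
      · rw [stretch_coe_of_le h] at hu
        exact absurd hu (infty_ne_coe u)
  | coe v =>
    have hemb : IsOpenEmbedding (Prod.map id (↑) : unitInterval × V → unitInterval × OnePoint V) :=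
      IsOpenEmbedding.id.prodMap isOpenEmbedding_coe
    refine (hemb.continuousAt_iff (x := (s, v))).1 ?_
    have hc : Continuous fun p : unitInterval × V => (p.1 : ℝ) * ‖p.2‖ := by fun_prop
    rcases lt_or_ge ((s : ℝ) * ‖v‖) 1 with h | h
    · have hev : (fun p : unitInterval × V => ((((1 - (p.1 : ℝ) * ‖p.2‖)⁻¹ • p.2 : V)) :
          OnePoint V)) =ᶠ[𝓝 (s, v)]
          ((fun p : unitInterval × OnePoint V => stretch (p.1 : ℝ) p.2) ∘ Prod.map id (↑)) := by
        filter_upwards [hc.continuousAt.eventually_lt continuousAt_const h] with p hp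
        exact (stretch_coe_of_lt hp).symm
      refine ContinuousAt.congr ?_ hev
      refine continuous_coe.continuousAt.comp ?_
      refine ContinuousAt.smul (ContinuousAt.inv₀ ?_ ?_) continuous_snd.continuousAt
      · exact (continuous_const.sub hc).continuousAt
      · exact (sub_pos.2 h).ne'
    · rw [ContinuousAt]
      simp only [Function.comp_apply, Prod.map_apply, id_eq, stretch_coe_of_le h]
      refine tendsto_infty_iff_norm.2 fun R => ?_
      have hv : 0 < ‖v‖ := by
        by_contra hv
        rw [le_antisymm (not_lt.1 hv) (norm_nonneg _)] at h
        norm_num at h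
      -- The stretched vector has norm `‖v‖ / (1 - s * ‖v‖)`, which exceeds `R` once `|R| * (1 - s *
      -- ‖v‖) < ‖v‖`. This is an open condition, and it holds at the limit point because the left
      -- side is nonpositive there.
      have hlt : |R| * (1 - (s : ℝ) * ‖v‖) < ‖v‖ :=
        (mul_nonpos_of_nonneg_of_nonpos (abs_nonneg R) (by linarith)).trans_lt hv
      have hc' : Continuous fun p : unitInterval × V => |R| * (1 - (p.1 : ℝ) * ‖p.2‖) := by
        fun_prop
      filter_upwards [hc'.continuousAt.eventually_lt continuous_snd.norm.continuousAt hlt]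
        with p hp u hu
      obtain ⟨s', v'⟩ := p
      change stretch (s' : ℝ) (v' : OnePoint V) = u at hu
      rcases lt_or_ge ((s' : ℝ) * ‖v'‖) 1 with h' | h'
      · rw [stretch_coe_of_lt h'] at hu
        have hpos : 0 < 1 - (s' : ℝ) * ‖v'‖ := by linarith
        rw [← coe_injective hu, norm_smul, norm_inv, Real.norm_of_nonneg hpos.le,
          inv_mul_eq_div, lt_div_iff₀ hpos]
        exact (mul_le_mul_of_nonneg_right (le_abs_self R) hpos.le).trans_lt hp
      · rw [stretch_coe_of_le h'] at hu
        exact absurd hu (infty_ne_coe u)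

end Stretch

end OnePoint

/-! ### Non-degenerate base points -/

/-- A non-degenerate base point has a neighbourhood which can be deformed to it within `X`. -/
theorem IsNondegenerate.exists_contraction {X : Type*} [TopologicalSpace X] {x₀ : X}
    (hx₀ : IsNondegenerate x₀) :
    ∃ (u : X → ℝ) (h : unitInterval × X → X), Continuous u ∧ Continuous h ∧ u x₀ = 1 ∧
      (∀ x, h (0, x) = x) ∧ (∀ s, h (s, x₀) = x₀) ∧ ∀ x, 0 < u x → h (1, x) = x₀ := by
  -- The universal case of homotopy extension: the target is `X × {0} ∪ {x₀} × I`. The two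
  -- coordinates of `H` give `h` and, at time `1`, `u`; a positive second coordinate forces the
  -- first to be `x₀`.
  obtain ⟨H, hH0, hH⟩ := hx₀ {p : X × unitInterval // p.2 = 0 ∨ p.1 = x₀} ⟨fun x => ⟨(x, 0), Or.inl rfl⟩, by fun_prop⟩
    ⟨fun s => ⟨(x₀, s), Or.inr rfl⟩, by fun_prop⟩ rfl
  refine ⟨fun x => ((H (x, 1)).1.2 : ℝ), fun p => (H (p.2, p.1)).1.1, by fun_prop, by fun_prop,
    ?_, fun x => ?_, fun s => ?_, fun x hx => ?_⟩
  · simp [hH]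
  · simp [hH0]
  · simp [hH]
  · rcases (H (x, 1)).2 with h | h
    · simp [h] at hx
    · exact h

/-! ### Collapsing a subset -/

namespace Collapse

variable {Y T : Type*} {A : Set Y}

theorem isQuotientMap_mk [TopologicalSpace Y] (A : Set Y) : IsQuotientMap (Collapse.mk A) :=
  isQuotientMap_quot_mk

theorem mk_eq_mk (a b : Y) (ha : a ∈ A) (hb : b ∈ A) : Collapse.mk A a = Collapse.mk A b :=
  Quot.sound ⟨ha, hb⟩

theorem exists_lift (f : Y → T) (t₀ : T) (hf : ∀ a ∈ A, f a = t₀) :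
    ∃ g : Collapse A → T, ∀ y, g (Collapse.mk A y) = f y :=
  ⟨Quot.lift f fun a b h => (hf a h.1).trans (hf b h.2).symm, fun _ => rfl⟩

/-- The predicate "equal to `b`, or in `A` together with `b`" is constant on `A`, so it descends to
the quotient and can be compared at `a` and `b`. -/
theorem eq_or_mem_of_mk_eq_mk {a b : Y} (h : Collapse.mk A a = Collapse.mk A b) :
    a = b ∨ a ∈ A ∧ b ∈ A := by
  obtain ⟨g, hg⟩ := exists_lift (A := A) (fun y => y = b ∨ y ∈ A ∧ b ∈ A) (b ∈ A) fun a ha => by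
    by_cases hb : b ∈ A
    · simp [ha, hb]
    · simp only [hb, and_false, or_false, eq_iff_iff, iff_false]
      rintro rfl
      exact hb ha
  have := (hg a).symm.trans ((congrArg g h).trans (hg b))
  simpa using this

end Collapse

/-! ### The `k`-adic construction as a quotient of `F(M, k) × X^k` -/

namespace AdicConstruction

variable {M X T : Type*} {M₀ : Set M} {x₀ : X} {k : ℕ}

/-- The class of a configuration of at most `k` labelled points. -/
def ofLabelledConf (M₀ : Set M) (x₀ : X) (k : ℕ) (p : LabelledConf M X k) :
    AdicConstruction M₀ x₀ k :=
  Collapse.mk (LabelFiltration.lower M₀ x₀ k) (Quot.mk (LabelledConf.Step M₀ x₀ k) p)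

/-- The class of a configuration of `k` labelled points. -/
def mk (M₀ : Set M) (x₀ : X) (k : ℕ) (z : Conf M k × (Fin k → X)) : AdicConstruction M₀ x₀ k :=
  ofLabelledConf M₀ x₀ k ⟨Fin.last k, z⟩

theorem ofLabelledConf_eq {p q : LabelledConf M X k} (h : LabelledConf.Step M₀ x₀ k p q) :
    ofLabelledConf M₀ x₀ k p = ofLabelledConf M₀ x₀ k q :=
  congrArg (Collapse.mk (LabelFiltration.lower M₀ x₀ k)) (Quot.sound h)

theorem mk_perm (m : Conf M k) (a : Fin k → X) (σ : Equiv.Perm (Fin k)) :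
    mk M₀ x₀ k (m.perm σ, fun i => a (σ i)) = mk M₀ x₀ k (m, a) :=
  (ofLabelledConf_eq (LabelledConf.Step.perm (Fin.last k) m a σ)).symm

theorem mk_of_lt (hk : 0 < k) (p : LabelledConf M X k) (hp : (p.1 : ℕ) < k) :
    ofLabelledConf M₀ x₀ k p = base M₀ x₀ k :=
  Collapse.mk_eq_mk _ _ ⟨p, hp, rfl⟩ ⟨_, hk, rfl⟩

/-- Only the last point may be dropped, so a transposition first moves the `i`-th point there. -/
theorem mk_eq_base {m : Conf M k} {a : Fin k → X} (i : Fin k) (h : m.1 i ∈ M₀ ∨ a i = x₀) :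
    mk M₀ x₀ k (m, a) = base M₀ x₀ k := by
  obtain _ | k := k
  · exact i.elim0
  rw [← mk_perm m a (Equiv.swap i (Fin.last k)), mk]
  have hs := LabelledConf.Step.drop (M₀ := M₀) (x₀ := x₀) (k := k + 1) k (Nat.lt_succ_self _)
    (m.perm (Equiv.swap i (Fin.last k))) (fun j => a (Equiv.swap i (Fin.last k) j))
    (by simpa [Conf.perm] using h)
  exact (ofLabelledConf_eq hs).trans (mk_of_lt k.succ_pos _ (Nat.lt_succ_self k))

theorem exists_lift (hk : 0 < k) (f : Conf M k × (Fin k → X) → T) (t₀ : T)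
    (hσ : ∀ m a (σ : Equiv.Perm (Fin k)), f (m.perm σ, fun i => a (σ i)) = f (m, a))
    (hf : ∀ (m : Conf M k) (a : Fin k → X) i, m.1 i ∈ M₀ ∨ a i = x₀ → f (m, a) = t₀) :
    ∃ g : AdicConstruction M₀ x₀ k → T, (∀ z, g (mk M₀ x₀ k z) = f z) ∧ g (base M₀ x₀ k) = t₀ := by
  classical
  -- Strata of fewer than `k` points go to `t₀`, the value forced at the base point.
  let F : LabelledConf M X k → T := fun p =>
    if h : p.1 = Fin.last k then
      f (h ▸ p.2 : Conf M (Fin.last k : Fin (k + 1)) × (Fin (Fin.last k : Fin (k + 1)) → X)) else t₀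
  have hF : ∀ p q, LabelledConf.Step M₀ x₀ k p q → F p = F q := by
    rintro _ _ (⟨j, m, a, σ⟩ | ⟨j, hj, m, a, h⟩)
    · by_cases hjk : j = Fin.last k
      · subst hjk
        simpa [F] using (hσ m a σ).symm
      · simp [F, hjk]
    · have h2 : F ⟨⟨j, Nat.lt_of_succ_lt hj⟩, m.init, fun i => a i.castSucc⟩ = t₀ :=
        dif_neg fun h => by
          have := congrArg Fin.val h
          simp only [Fin.val_last] at this
          lia
      rw [h2]
      by_cases hjk : j + 1 = k
      · subst hjk
        exact (dif_pos (rfl : (⟨j + 1, hj⟩ : Fin (j + 1 + 1)) = Fin.last (j + 1))).trans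
          (hf m a _ h)
      · exact dif_neg fun h => hjk (congrArg Fin.val h)
  have hlow : ∀ p : LabelledConf M X k, (p.1 : ℕ) < k → F p = t₀ := fun p hp =>
    dif_neg fun h => by
      rw [h] at hp
      exact lt_irrefl _ hp
  obtain ⟨g, hg⟩ := Collapse.exists_lift (A := LabelFiltration.lower M₀ x₀ k)
    (Quot.lift F hF) t₀ (by rintro _ ⟨p, hp, rfl⟩; exact hlow p hp)
  exact ⟨g, fun z => (hg _).trans (dif_pos (rfl : Fin.last k = Fin.last k)), (hg _).trans (hlow _ hk)⟩

theorem exists_rep (c : AdicConstruction M₀ x₀ k) :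
    (∃ p : LabelledConf M X k, (p.1 : ℕ) < k ∧ ofLabelledConf M₀ x₀ k p = c) ∨
      ∃ z, mk M₀ x₀ k z = c := by
  obtain ⟨⟨⟨j, z⟩⟩⟩ := c
  by_cases hj : j = Fin.last k
  · subst hj
    exact Or.inr ⟨z, rfl⟩
  · exact Or.inl ⟨⟨j, z⟩, Fin.val_lt_last hj, rfl⟩

theorem subsingleton_of_isEmpty (hk : 0 < k) [IsEmpty (Conf M k)]
    (c : AdicConstruction M₀ x₀ k) : c = base M₀ x₀ k := by
  obtain ⟨p, hp, rfl⟩ | ⟨z, -⟩ := exists_rep c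
  · exact mk_of_lt hk p hp
  · exact isEmptyElim z.1

theorem mk_surjective (hk : 0 < k) [Nonempty (Conf M k)] :
    Function.Surjective (mk M₀ x₀ k) := by
  intro c
  obtain ⟨p, hp, rfl⟩ | h := exists_rep c
  · rw [mk_of_lt hk p hp]
    exact ⟨(Classical.arbitrary _, fun _ => x₀), mk_eq_base ⟨0, hk⟩ (Or.inr rfl)⟩
  · exact h

variable [TopologicalSpace M] [TopologicalSpace X]

theorem isQuotientMap_ofLabelledConf : IsQuotientMap (ofLabelledConf M₀ x₀ k) :=
  (Collapse.isQuotientMap_mk (LabelFiltration.lower M₀ x₀ k)).comp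
    (isQuotientMap_quot_mk (r := LabelledConf.Step M₀ x₀ k))

theorem continuous_mk : Continuous (mk M₀ x₀ k) :=
  isQuotientMap_ofLabelledConf.continuous.comp
    (continuous_sigmaMk (σ := fun j : Fin (k + 1) => Conf M j × (Fin j → X)) (i := Fin.last k))

/-- Each lower stratum maps to the base point, so the preimage of a set in it is empty or
everything, and openness is tested on the top stratum alone. A configuration of `k` points is needed
to reach the base point from there. -/
theorem isQuotientMap_mk (hk : 0 < k) [Nonempty (Conf M k)] : IsQuotientMap (mk M₀ x₀ k) := by
  refine (isQuotientMap_iff _).2 ⟨isCoinducing_iff.2 fun s =>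
    ⟨fun hs => ?_, fun hs => hs.preimage continuous_mk⟩, mk_surjective hk⟩
  rw [← isQuotientMap_ofLabelledConf.isOpen_preimage, isOpen_sigma_iff]
  intro j
  by_cases hj : j = Fin.last k
  · subst hj
    exact hs
  · have h : ∀ z : Conf M j × (Fin j → X), 
        ofLabelledConf M₀ x₀ k ⟨j, z⟩ = base M₀ x₀ k := fun z => mk_of_lt hk _ (Fin.val_lt_last hj)
    by_cases hb : base M₀ x₀ k ∈ s
    · convert isOpen_univ
      exact Set.eq_univ_of_forall fun z => show ofLabelledConf M₀ x₀ k ⟨j, z⟩ ∈ s from (h z).symm ▸ hb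
    · convert isOpen_empty
      exact Set.eq_empty_of_forall_notMem fun z (hz : ofLabelledConf M₀ x₀ k ⟨j, z⟩ ∈ s) =>
        hb (h z ▸ hz)

/-- Homotopies out of the `k`-adic construction. -/
theorem exists_continuous_lift {K : Type*} [TopologicalSpace K] [LocallyCompactSpace K]
    [TopologicalSpace T] (hk : 0 < k) [Nonempty (Conf M k)]
    (f : K × (Conf M k × (Fin k → X)) → T) (t₀ : T) (hc : Continuous f)
    (hσ : ∀ s m a (σ : Equiv.Perm (Fin k)), f (s, m.perm σ, fun i => a (σ i)) = f (s, m, a))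
    (hf : ∀ s (m : Conf M k) (a : Fin k → X) i, m.1 i ∈ M₀ ∨ a i = x₀ → f (s, m, a) = t₀) :
    ∃ g : K × AdicConstruction M₀ x₀ k → T, Continuous g ∧
      (∀ s z, g (s, mk M₀ x₀ k z) = f (s, z)) ∧ ∀ s, g (s, base M₀ x₀ k) = t₀ := by
  have h s := exists_lift hk (fun z => f (s, z)) t₀ (hσ s) (hf s)
  choose g hg hg₀ using h
  refine ⟨fun p => g p.1 p.2, ?_, hg, hg₀⟩
  -- The product of a quotient map with a locally compact space is again a quotient map.
  refine (isQuotientMap_mk hk).continuous_lift_prod_right ?_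
  simpa only [hg] using hc

end AdicConstruction

/-! ### Trivializations of Whitney powers of the canonical bundle -/

/-- A family of linear isomorphisms `V^k ≃ W`, parametrized continuously by `F(M, k)` and invariant
under the simultaneous permutation of the points and of the entries. -/
structure ConfTrivialization (M : Type*) [TopologicalSpace M] (k : ℕ) (V W : Type*)
    [NormedAddCommGroup V] [NormedSpace ℝ V] [NormedAddCommGroup W] [NormedSpace ℝ W] where
  /-- The isomorphism over an ordered configuration. -/
  toEquiv : Conf M k → (Fin k → V) ≃L[ℝ] W
  continuous_toEquiv : Continuous fun p : Conf M k × (Fin k → V) => toEquiv p.1 p.2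
  continuous_symm : Continuous fun p : Conf M k × W => (toEquiv p.1).symm p.2
  toEquiv_perm : ∀ (m : Conf M k) (v : Fin k → V) (σ : Equiv.Perm (Fin k)),
    toEquiv (m.perm σ) (fun i => v (σ i)) = toEquiv m v

/-- Inversion is continuous on continuous families of linear isomorphisms of finite-dimensional
spaces. -/
theorem continuous_symm_of_continuous_family {B E E' : Type*} [TopologicalSpace B]
    [NormedAddCommGroup E] [NormedSpace ℝ E] [FiniteDimensional ℝ E]
    [NormedAddCommGroup E'] [NormedSpace ℝ E'] [FiniteDimensional ℝ E'] (G : B → E ≃L[ℝ] E')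
    (hG : Continuous fun p : B × E => G p.1 p.2) :
    Continuous fun p : B × E' => (G p.1).symm p.2 := by
  have : CompleteSpace E := FiniteDimensional.complete ℝ E
  have h1 : Continuous fun b => (G b : E →L[ℝ] E') :=
    continuous_clm_apply.2 fun y => hG.comp (by fun_prop : Continuous fun b : B => (b, y))
  have h2 : Continuous fun b => ((G b).symm : E' →L[ℝ] E) := by
    rw [continuous_iff_continuousAt]
    intro b
    -- Operator inversion is continuous at invertible operators.
    have := (contDiffAt_map_inverse (𝕜 := ℝ) (n := 0) (G b)).continuousAt.comp
      (f := fun b => (G b : E →L[ℝ] E')) h1.continuousAt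
    simpa [Function.comp_def] using this
  exact (h2.comp continuous_fst).clm_apply continuous_snd

section CanonicalBundle

variable {M : Type*} {k o : ℕ}

/-- The point of the Whitney power of the canonical bundle given by an ordering of a configuration
and coordinates. -/
noncomputable def confWhitneyMk (o : ℕ) (p : Conf M k × (Fin o → Fin k → ℝ)) :
    Bundle.TotalSpace (Fin o → Fin k → ℝ) (WhitneyPower (ConfFiber M k) o) :=
  ⟨Quotient.mk _ p.1, fun i => ConfFiber.equiv p.1 rfl (p.2 i)⟩

theorem continuous_confWhitneyMk [TopologicalSpace M] : Continuous (confWhitneyMk (M := M) (k := k) o) := by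
  refine continuous_induced_rng.2 (Continuous.prodMk ?_ (continuous_pi fun i => ?_))
  · exact continuous_quotient_mk'.comp continuous_fst
  · refine continuous_induced_rng.2 ?_
    exact continuous_quotient_mk'.comp
      (continuous_fst.prodMk ((continuous_apply i).comp continuous_snd))

theorem confWhitneyMk_perm (m : Conf M k) (v : Fin o → Fin k → ℝ) (σ : Equiv.Perm (Fin k)) :
    confWhitneyMk o (m.perm σ, fun i j => v i (σ j)) = confWhitneyMk o (m, v) := by
  -- The two sides lie over base points that are equal but not definitionally so; making the base
  -- point a variable avoids a transport between fibres.
  have hb : ∀ (b : UConf M k) (hm : (Quotient.mk _ m : UConf M k) = b), confWhitneyMk o (m, v) =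
      ⟨b, fun i => ConfFiber.equiv m hm (v i)⟩ := by
    rintro b rfl
    rfl
  rw [hb _ (Quotient.sound ⟨σ, rfl⟩ : (Quotient.mk _ m : UConf M k) = Quotient.mk _ (m.perm σ)),
    confWhitneyMk]
  congr 1
  ext i
  exact Subtype.ext (Quotient.sound (Setoid.symm ⟨σ, rfl, rfl⟩))

variable [TopologicalSpace M]

/-- A trivialization of the `o`-th Whitney power of the canonical bundle over a nonempty
configuration space. -/
theorem exists_family_of_isTrivialBundle [Nonempty (Conf M k)]
    (h : IsTrivialBundle (Fin o → Fin k → ℝ) (WhitneyPower (ConfFiber M k) o)) :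
    ∃ G : Conf M k → (Fin o → Fin k → ℝ) ≃L[ℝ] (Fin (o * k) → ℝ),
      (Continuous fun p : Conf M k × (Fin o → Fin k → ℝ) => G p.1 p.2) ∧
      ∀ (m : Conf M k) (v : Fin o → Fin k → ℝ) (σ : Equiv.Perm (Fin k)),
        G (m.perm σ) (fun i j => v i (σ j)) = G m v := by
  obtain ⟨n, Φ, hΦ, hlin⟩ := h
  -- An ordering supplies coordinates on the fibre, so the trivialization becomes a family of linear
  -- maps between fixed spaces.
  let L (m : Conf M k) : (Fin o → Fin k → ℝ) →ₗ[ℝ] (Fin n → ℝ) :=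
    { toFun := fun v => (Φ (confWhitneyMk o (m, v))).2
      map_add' := fun v w => by
        refine Eq.trans ?_ ((hlin (Quotient.mk _ m)).map_add
          (fun i => ConfFiber.equiv m rfl (v i)) fun i => ConfFiber.equiv m rfl (w i))
        exact congrArg (fun e => (Φ ⟨Quotient.mk _ m, e⟩).2)
          (funext fun i => (ConfFiber.isLinearMap_equiv m rfl).map_add (v i) (w i))
      map_smul' := fun c v => by
        refine Eq.trans ?_ ((hlin (Quotient.mk _ m)).map_smul c
          fun i => ConfFiber.equiv m rfl (v i))
        exact congrArg (fun e => (Φ ⟨Quotient.mk _ m, e⟩).2)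
          (funext fun i => (ConfFiber.isLinearMap_equiv m rfl).map_smul c (v i)) }
  have hbij (m : Conf M k) : Function.Bijective (L m) := by
    constructor
    · intro v w hvw
      have h1 : Φ (confWhitneyMk o (m, v)) = Φ (confWhitneyMk o (m, w)) :=
        Prod.ext ((hΦ (confWhitneyMk o (m, v))).trans (hΦ (confWhitneyMk o (m, w))).symm) hvw
      have h2 := Φ.injective h1
      ext i : 1
      have h3 : (fun i => ConfFiber.equiv m rfl (v i)) = fun i => ConfFiber.equiv m rfl (w i) := by
        simpa [confWhitneyMk] using h2
      exact (ConfFiber.equiv m rfl).injective (congrFun h3 i)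
    · intro u
      obtain ⟨⟨b, e⟩, he⟩ := Φ.surjective (Quotient.mk _ m, u)
      obtain rfl : b = Quotient.mk _ m := (hΦ ⟨b, e⟩).symm.trans (congrArg Prod.fst he)
      refine ⟨fun i => (ConfFiber.equiv m rfl).symm (e i), ?_⟩
      change (Φ (confWhitneyMk o _)).2 = u
      simp [confWhitneyMk, he]
  let G₀ (m : Conf M k) := LinearEquiv.ofBijective (L m) (hbij m)
  -- The rank of the trivial bundle is read off at one configuration.
  obtain rfl : o * k = n := by
    simpa [Module.finrank_pi_fintype] using (G₀ (Classical.arbitrary _)).finrank_eq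
  refine ⟨fun m => (G₀ m).toContinuousLinearEquiv, ?_, fun m v σ => ?_⟩
  · exact continuous_snd.comp (Φ.continuous.comp continuous_confWhitneyMk)
  -- Invariance is automatic: both arguments name the same point of the total space.
  · exact congrArg (fun z => (Φ z).2) (confWhitneyMk_perm m v σ)

theorem nonempty_confTrivialization [Nonempty (Conf M k)] (t : ℕ)
    (h : IsTrivialBundle (Fin o → Fin k → ℝ) (WhitneyPower (ConfFiber M k) o)) :
    Nonempty (ConfTrivialization M k (Fin (t * o) → ℝ) (Fin (k * t * o) → ℝ)) := by
  obtain ⟨G, hG, hσ⟩ := exists_family_of_isTrivialBundle h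
  -- Splits `ℝ^(t·o)` into `t` blocks `ℝ^o` and moves the index of the point innermost, so that `G
  -- m` can act on each block.
  let e₁ : (Fin k → Fin (t * o) → ℝ) ≃L[ℝ] (Fin t → Fin o → Fin k → ℝ) :=
    LinearEquiv.toContinuousLinearEquiv
      { toFun := fun v a b i => v i (finProdFinEquiv (a, b))
        invFun := fun v i c => v (finProdFinEquiv.symm c).1 (finProdFinEquiv.symm c).2 i
        left_inv := fun v =>
          funext fun i => funext fun c => congrArg (v i) (finProdFinEquiv.apply_symm_apply c)
        right_inv := fun v => by
          ext a b i
          simp only [Equiv.symm_apply_apply]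
        map_add' := fun _ _ => rfl
        map_smul' := fun _ _ => rfl }
  let e₂ : (Fin t → Fin (o * k) → ℝ) ≃L[ℝ] (Fin (k * t * o) → ℝ) :=
    ContinuousLinearEquiv.ofFinrankEq (by
      simp only [Module.finrank_fintype_fun_eq_card, Module.finrank_pi_fintype, Finset.sum_const,
        Finset.card_univ, Fintype.card_fin, smul_eq_mul]
      ring)
  let H (m : Conf M k) : (Fin k → Fin (t * o) → ℝ) ≃L[ℝ] (Fin (k * t * o) → ℝ) :=
    (e₁.trans (ContinuousLinearEquiv.piCongrRight fun _ => G m)).trans e₂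
  have hH : Continuous fun p : Conf M k × (Fin k → Fin (t * o) → ℝ) => H p.1 p.2 := by
    refine e₂.continuous.comp (continuous_pi fun a => ?_)
    exact hG.comp (continuous_fst.prodMk
      ((continuous_apply a).comp (e₁.continuous.comp continuous_snd)))
  refine ⟨⟨H, hH, continuous_symm_of_continuous_family H hH, fun m v σ => ?_⟩⟩
  exact congrArg e₂ (funext fun a => hσ m (e₁ v a) σ)

end CanonicalBundle

/-! ### Smash products with the `k`-adic construction -/

namespace Smash

variable {Y Z : Type*}

/-- The class of a pair in the smash product. -/
def mk (y₀ : Y) (z₀ : Z) (p : Y × Z) : Smash y₀ z₀ :=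
  Collapse.mk {p : Y × Z | p.1 = y₀ ∨ p.2 = z₀} p

variable {y₀ : Y} {z₀ : Z}

theorem mk_eq_base {p : Y × Z} (h : p.1 = y₀ ∨ p.2 = z₀) : mk y₀ z₀ p = base y₀ z₀ :=
  Collapse.mk_eq_mk _ _ h (Or.inl rfl)

theorem isQuotientMap_mk [TopologicalSpace Y] [TopologicalSpace Z] (y₀ : Y) (z₀ : Z) :
    IsQuotientMap (mk y₀ z₀) :=
  Collapse.isQuotientMap_mk _

theorem mk_surjective (y₀ : Y) (z₀ : Z) : Function.Surjective (mk y₀ z₀) :=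
  Quot.mk_surjective

theorem eq_or_of_mk_eq_mk {p q : Y × Z} (h : mk y₀ z₀ p = mk y₀ z₀ q) :
    p = q ∨ (p.1 = y₀ ∨ p.2 = z₀) ∧ (q.1 = y₀ ∨ q.2 = z₀) :=
  Collapse.eq_or_mem_of_mk_eq_mk h

/-- A choice of representatives in the smash product. -/
noncomputable def rep (y : Smash y₀ z₀) : Y × Z :=
  Function.surjInv (mk_surjective y₀ z₀) y

@[simp]
theorem mk_rep (y : Smash y₀ z₀) : mk y₀ z₀ (rep y) = y :=
  Function.surjInv_eq _ y

end Smash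

namespace ConfTrivialization

section Extend

variable {k : ℕ} {V T : Type*} (t₀ : T)

/-- The extension of a function on `V^k` to the one-point compactification. -/
def extend (f : (Fin k → OnePoint V) → T) (w : OnePoint (Fin k → V)) : T :=
  OnePoint.elim w t₀ fun v => f fun i => (v i : OnePoint V)

theorem extend_ofPi {t₀ : T} {f : (Fin k → OnePoint V) → T}
    (hf : ∀ w, (∃ i, w i = OnePoint.infty) → f w = t₀) (w : Fin k → OnePoint V) :
    extend t₀ f (OnePoint.ofPi w) = f w := by
  obtain h | ⟨v, rfl⟩ := OnePoint.exists_eq_infty_or_exists_coe w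
  · rw [OnePoint.ofPi_eq_infty h, hf w h]
    rfl
  · rw [OnePoint.ofPi_coe]
    rfl

/-- `ofPi` maps a compact space to a Hausdorff one, hence is proper, and its product with the
identity of an arbitrary `B` is a closed surjection. No local compactness of `B` is required. -/
theorem continuous_extend [NormedAddCommGroup V] [ProperSpace V] {B : Type*} [TopologicalSpace B] [TopologicalSpace T] {t₀ : T}
    (hk : 0 < k) {f : B → (Fin k → OnePoint V) → T}
    (hf : ∀ b w, (∃ i, w i = OnePoint.infty) → f b w = t₀)
    (hc : Continuous fun p : B × (Fin k → OnePoint V) => f p.1 p.2) :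
    Continuous fun p : B × OnePoint (Fin k → V) => extend t₀ (f p.1) p.2 := by
  have : Nonempty (Fin k) := ⟨⟨0, hk⟩⟩
  have hq : IsQuotientMap (Prod.map id OnePoint.ofPi :
      B × (Fin k → OnePoint V) → B × OnePoint (Fin k → V)) := by
    have hp := (IsHomeomorph.id (X := B)).isProperMap.prodMap
      (OnePoint.continuous_ofPi (ι := Fin k) (V := V)).isProperMap
    exact hp.isClosedMap.isQuotientMap hp.continuous
      (Function.surjective_id.prodMap OnePoint.ofPi_surjective)
  rw [hq.continuous_iff]
  refine hc.congr fun p => ?_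
  exact (extend_ofPi (hf p.1) p.2).symm

end Extend

variable {M : Type*} [TopologicalSpace M] {k : ℕ}
  {V W : Type*} [NormedAddCommGroup V] [NormedSpace ℝ V] [NormedAddCommGroup W] [NormedSpace ℝ W]
  {X : Type*}

variable (G : ConfTrivialization M k V W) (M₀ : Set M) (x₀ : X)

/-- The projection of `F(M, k) × (S^V)^k × X^k` onto `S^W ∧ D_k(M, M₀; X)`. -/
noncomputable def smashMk (z : Conf M k × (Fin k → OnePoint V) × (Fin k → X)) :
    Smash (OnePoint.infty : OnePoint W) (AdicConstruction.base M₀ x₀ k) :=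
  Smash.mk _ _ (OnePoint.map (G.toEquiv z.1) (OnePoint.ofPi z.2.1),
    AdicConstruction.mk M₀ x₀ k (z.1, z.2.2))

theorem smashMk_perm (m : Conf M k) (w : Fin k → OnePoint V) (a : Fin k → X)
    (σ : Equiv.Perm (Fin k)) :
    G.smashMk M₀ x₀ (m.perm σ, (fun i => w (σ i)), fun i => a (σ i)) =
      G.smashMk M₀ x₀ (m, w, a) := by
  have h : OnePoint.map (G.toEquiv (m.perm σ)) (OnePoint.ofPi fun i => w (σ i)) =
      OnePoint.map (G.toEquiv m) (OnePoint.ofPi w) := by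
    rw [OnePoint.ofPi_perm, ← Function.comp_apply (f := OnePoint.map _), ← OnePoint.map_comp]
    exact congrArg (OnePoint.map · (OnePoint.ofPi w))
      (funext fun v => G.toEquiv_perm m v σ)
  rw [smashMk, h, AdicConstruction.mk_perm]
  rfl

theorem smashMk_eq_base {m : Conf M k} {w : Fin k → OnePoint V} {a : Fin k → X} (i : Fin k)
    (h : m.1 i ∈ M₀ ∨ w i = OnePoint.infty ∨ a i = x₀) :
    G.smashMk M₀ x₀ (m, w, a) = Smash.base _ _ := by
  obtain h | h | h := h
  · exact Smash.mk_eq_base (Or.inr (AdicConstruction.mk_eq_base i (Or.inl h)))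
  · refine Smash.mk_eq_base (Or.inl ?_)
    rw [OnePoint.ofPi_eq_infty ⟨i, h⟩]
    rfl
  · exact Smash.mk_eq_base (Or.inr (AdicConstruction.mk_eq_base i (Or.inr h)))

theorem smashMk_surjective (hk : 0 < k) [Nonempty (Conf M k)] :
    Function.Surjective (G.smashMk M₀ x₀) := by
  have : Nonempty (Fin k) := ⟨⟨0, hk⟩⟩
  intro c
  obtain ⟨⟨v, d⟩, rfl⟩ := Smash.mk_surjective _ _ c
  obtain ⟨⟨m, a⟩, rfl⟩ := AdicConstruction.mk_surjective hk d
  obtain ⟨w, hw⟩ := OnePoint.ofPi_surjective (OnePoint.map (G.toEquiv m).symm v)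
  refine ⟨(m, w, a), ?_⟩
  rw [smashMk, hw, ← Function.comp_apply (f := OnePoint.map _), ← OnePoint.map_comp]
  simp

variable [TopologicalSpace X] [FiniteDimensional ℝ V] [FiniteDimensional ℝ W]

theorem continuous_smashMk : Continuous (G.smashMk M₀ x₀) := by
  have : ProperSpace V := FiniteDimensional.proper_real V
  refine (Smash.isQuotientMap_mk _ _).continuous.comp (Continuous.prodMk ?_ ?_)
  · exact (OnePoint.continuous_map_family G.toEquiv G.continuous_toEquiv G.continuous_symm).comp
      (continuous_fst.prodMk
        (OnePoint.continuous_ofPi.comp (continuous_fst.comp continuous_snd)))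
  · exact AdicConstruction.continuous_mk.comp
      (continuous_fst.prodMk (continuous_snd.comp continuous_snd))

variable {M₀ x₀}

/-- Homotopies out of `S^W ∧ D_k(M, M₀; X)`. -/
theorem exists_continuous_lift {K T : Type*} [TopologicalSpace K] [LocallyCompactSpace K]
    [TopologicalSpace T] (hk : 0 < k) [Nonempty (Conf M k)]
    (f : K × (Conf M k × (Fin k → OnePoint V) × (Fin k → X)) → T) (t₀ : T) (hc : Continuous f)
    (hσ : ∀ s m w a (σ : Equiv.Perm (Fin k)),
      f (s, m.perm σ, (fun i => w (σ i)), fun i => a (σ i)) = f (s, m, w, a))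
    (hf : ∀ s (m : Conf M k) (w : Fin k → OnePoint V) (a : Fin k → X) i,
      m.1 i ∈ M₀ ∨ w i = OnePoint.infty ∨ a i = x₀ → f (s, m, w, a) = t₀) :
    ∃ g : K × Smash (OnePoint.infty : OnePoint W) (AdicConstruction.base M₀ x₀ k) → T,
      Continuous g ∧ (∀ s z, g (s, G.smashMk M₀ x₀ z) = f (s, z)) ∧
        ∀ s, g (s, Smash.base _ _) = t₀ := by
  have : ProperSpace V := FiniteDimensional.proper_real V
  -- The function is pushed down in stages: from `(S^V)^k` to the compactification of `V^k`, then to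
  -- `S^W` through the inverse isomorphisms. With `K × S^W` as a locally compact parameter space it
  -- descends to the `k`-adic construction, and finally to the smash product.
  let B (b : K × Conf M k × (Fin k → X)) (w : OnePoint (Fin k → V)) : T :=
    extend t₀ (fun w => f (b.1, b.2.1, w, b.2.2)) w
  have hf' (b : K × Conf M k × (Fin k → X)) (w : Fin k → OnePoint V)
      (h : ∃ i, w i = OnePoint.infty) : f (b.1, b.2.1, w, b.2.2) = t₀ := by
    obtain ⟨i, hi⟩ := h
    exact hf _ _ _ _ i (Or.inr (Or.inl hi))
  have hB : Continuous fun p : (K × Conf M k × (Fin k → X)) × OnePoint (Fin k → V) =>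
      B p.1 p.2 :=
    continuous_extend hk hf' (hc.comp (by fun_prop :
      Continuous fun p : (K × Conf M k × (Fin k → X)) × (Fin k → OnePoint V) =>
        (p.1.1, p.1.2.1, p.2, p.1.2.2)))
  have hB0 : ∀ s (m : Conf M k) (a : Fin k → X) w i, m.1 i ∈ M₀ ∨ a i = x₀ →
      B (s, m, a) w = t₀ := by
    intro s m a w i h
    induction w using OnePoint.rec with
    | infty => rfl
    | coe v => exact hf _ _ _ _ i (h.imp id Or.inr)
  have hBσ : ∀ s (m : Conf M k) (a : Fin k → X) (v : OnePoint W) (σ : Equiv.Perm (Fin k)),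
      B (s, m.perm σ, fun i => a (σ i)) (OnePoint.map (G.toEquiv (m.perm σ)).symm v) =
        B (s, m, a) (OnePoint.map (G.toEquiv m).symm v) := by
    intro s m a v σ
    induction v using OnePoint.rec with
    | infty => rfl
    | coe u =>
      have hu : (G.toEquiv (m.perm σ)).symm u = fun i => (G.toEquiv m).symm u (σ i) := by
        rw [ContinuousLinearEquiv.symm_apply_eq, G.toEquiv_perm,
          ContinuousLinearEquiv.apply_symm_apply]
      change f (s, m.perm σ, (fun i => ((G.toEquiv (m.perm σ)).symm u i : OnePoint V)),
        fun i => a (σ i)) = f (s, m, (fun i => ((G.toEquiv m).symm u i : OnePoint V)), a)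
      rw [hu]
      exact hσ s m (fun i => ((G.toEquiv m).symm u i : OnePoint V)) a σ
  obtain ⟨L, hLc, hL, hL0⟩ := AdicConstruction.exists_continuous_lift (M₀ := M₀) (x₀ := x₀)
    (K := K × OnePoint W) hk
    (fun p => B (p.1.1, p.2) (OnePoint.map (G.toEquiv p.2.1).symm p.1.2)) t₀
    (hB.comp (Continuous.prodMk (by fun_prop)
      ((OnePoint.continuous_map_family (fun m => (G.toEquiv m).symm) G.continuous_symm
        G.continuous_toEquiv).comp (by fun_prop :
          Continuous fun p : (K × OnePoint W) × (Conf M k × (Fin k → X)) => (p.2.1, p.1.2)))))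
    (fun s m a σ => hBσ _ _ _ _ σ) (fun s m a i h => hB0 _ _ _ _ i h)
  have hL1 : ∀ s d, L ((s, OnePoint.infty), d) = t₀ := by
    intro s d
    obtain ⟨⟨m, a⟩, rfl⟩ := AdicConstruction.mk_surjective hk d
    rw [hL]
    rfl
  have hlift (s : K) := Collapse.exists_lift
    (A := {p : OnePoint W × AdicConstruction M₀ x₀ k |
      p.1 = OnePoint.infty ∨ p.2 = AdicConstruction.base M₀ x₀ k})
    (fun p => L ((s, p.1), p.2)) t₀ (by
      rintro ⟨v, d⟩ (rfl | rfl)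
      · exact hL1 s d
      · exact hL0 _)
  choose g hg using hlift
  refine ⟨fun p => g p.1 p.2, ?_, fun s z => ?_, fun s => (hg s _).trans (hL0 _)⟩
  · refine (Smash.isQuotientMap_mk _ _).continuous_lift_prod_right ?_
    refine (hLc.comp (by fun_prop : Continuous
      fun p : K × (OnePoint W × AdicConstruction M₀ x₀ k) => ((p.1, p.2.1), p.2.2))).congr ?_
    exact fun p => (hg p.1 p.2).symm
  · obtain ⟨m, w, a⟩ := z
    refine (hg s _).trans ((hL _ _).trans ?_)
    have : OnePoint.map (G.toEquiv m).symm (OnePoint.map (G.toEquiv m) (OnePoint.ofPi w)) =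
        OnePoint.ofPi w := by
      rw [← Function.comp_apply (f := OnePoint.map _), ← OnePoint.map_comp]
      simp
    change B (s, m, a) (OnePoint.map (G.toEquiv m).symm
      (OnePoint.map (G.toEquiv m) (OnePoint.ofPi w))) = _
    rw [this]
    exact extend_ofPi (hf' (s, m, a)) w

end ConfTrivialization

/-! ### Contractible neighbourhoods of base points -/

/-- A homotopy of `Y` rel base point from the identity to a map which is constant on an open
neighbourhood of the base point; a further open set, which does not contain the base point, covers
the rest of `Y`. -/
structure BaseContraction {Y : Type*} [TopologicalSpace Y] (y₀ : Y) where
  /-- The homotopy. -/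
  toFun : unitInterval × Y → Y
  /-- The neighbourhood of the base point which is contracted. -/
  near : Set Y
  /-- An open set which together with `near` covers the space. -/
  away : Set Y
  continuous_toFun : Continuous toFun
  isOpen_near : IsOpen near
  isOpen_away : IsOpen away
  near_or_away : ∀ y, y ∈ near ∨ y ∈ away
  base_notMem_away : y₀ ∉ away
  map_zero : ∀ y, toFun (0, y) = y
  map_base : ∀ s, toFun (s, y₀) = y₀
  map_one : ∀ y ∈ near, toFun (1, y) = y₀

theorem IsNondegenerate.nonempty_baseContraction {X : Type*} [TopologicalSpace X] {x₀ : X}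
    (hx₀ : IsNondegenerate x₀) : Nonempty (BaseContraction x₀) := by
  obtain ⟨u, h, hu, hh, hu₀, h_zero, h_base, h_one⟩ := hx₀.exists_contraction
  exact ⟨{
    toFun := h
    near := {x | 0 < u x}
    away := {x | u x < 1}
    continuous_toFun := hh
    isOpen_near := isOpen_lt continuous_const hu
    isOpen_away := isOpen_lt hu continuous_const
    near_or_away := fun x => (lt_or_ge 0 (u x)).imp id fun hx => lt_of_le_of_lt hx one_pos
    base_notMem_away := fun hx => hx.ne hu₀
    map_zero := h_zero
    map_base := h_base
    map_one := h_one }⟩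

/-- The contraction of a neighbourhood of `∞` in the one-point compactification of a
finite-dimensional normed space. -/
noncomputable def OnePoint.baseContraction (V : Type*) [NormedAddCommGroup V] [NormedSpace ℝ V]
    [ProperSpace V] : BaseContraction (OnePoint.infty : OnePoint V) where
  toFun p := stretch (p.1 : ℝ) p.2
  near := ((↑) '' Metric.closedBall (0 : V) 1)ᶜ
  away := {OnePoint.infty}ᶜ
  continuous_toFun := continuous_stretch
  isOpen_near := isOpen_compl_image_coe.2 ⟨Metric.isClosed_closedBall, isCompact_closedBall _ _⟩
  isOpen_away := isClosed_infty.isOpen_compl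
  near_or_away w := by
    induction w using OnePoint.rec with
    | infty => exact Or.inl infty_notMem_image_coe
    | coe v => exact Or.inr (coe_ne_infty v)
  base_notMem_away h := h rfl
  map_zero := stretch_zero
  map_base _ := rfl
  map_one w hw := by
    induction w using OnePoint.rec with
    | infty => rfl
    | coe v =>
      refine stretch_coe_of_le ?_
      by_contra hv
      exact hw ⟨v, by simpa using (not_le.1 hv).le, rfl⟩

namespace BaseContraction

variable {Y Z : Type*} [TopologicalSpace Y] [TopologicalSpace Z] {y₀ : Y} {z₀ : Z}

theorem base_mem_near (c : BaseContraction y₀) : y₀ ∈ c.near :=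
  (c.near_or_away y₀).resolve_right c.base_notMem_away

variable (c : BaseContraction y₀) (d : BaseContraction z₀)

/-- The induced homotopy of the smash product. -/
theorem exists_smash_homotopy :
    ∃ θ : unitInterval × Smash y₀ z₀ → Smash y₀ z₀, Continuous θ ∧
      ∀ s p, θ (s, Smash.mk y₀ z₀ p) = Smash.mk y₀ z₀ (c.toFun (s, p.1), d.toFun (s, p.2)) := by
  have h (s : unitInterval) := Collapse.exists_lift (A := {p : Y × Z | p.1 = y₀ ∨ p.2 = z₀})
    (fun p => Smash.mk y₀ z₀ (c.toFun (s, p.1), d.toFun (s, p.2))) (Smash.base y₀ z₀) (by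
      rintro ⟨y, z⟩ (rfl | rfl)
      · exact Smash.mk_eq_base (Or.inl (c.map_base s))
      · exact Smash.mk_eq_base (Or.inr (d.map_base s)))
  choose θ hθ using h
  refine ⟨fun p => θ p.1 p.2, (Smash.isQuotientMap_mk _ _).continuous_lift_prod_right ?_,
    fun s p => hθ s p⟩
  have hc := c.continuous_toFun
  have hd := d.continuous_toFun
  exact ((Smash.isQuotientMap_mk y₀ z₀).continuous.comp (by fun_prop :
    Continuous fun p : unitInterval × (Y × Z) =>
      (c.toFun (p.1, p.2.1), d.toFun (p.1, p.2.2)))).congr fun p => (hθ p.1 p.2).symm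

/-- An open set that contains the collapsed subset or misses it is saturated. -/
theorem isOpen_image_smashMk {U : Set (Y × Z)} (hU : IsOpen U)
    (h : (∀ p : Y × Z, p.1 = y₀ ∨ p.2 = z₀ → p ∈ U) ∨ ∀ p : Y × Z, p.1 = y₀ ∨ p.2 = z₀ → p ∉ U) :
    Smash.mk y₀ z₀ ⁻¹' (Smash.mk y₀ z₀ '' U) = U ∧ IsOpen (Smash.mk y₀ z₀ '' U) := by
  have hs : Smash.mk y₀ z₀ ⁻¹' (Smash.mk y₀ z₀ '' U) = U := by
    refine Set.Subset.antisymm ?_ (Set.subset_preimage_image _ _)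
    rintro q ⟨p, hp, hpq⟩
    obtain rfl | ⟨hp', hq⟩ := Smash.eq_or_of_mk_eq_mk hpq
    · exact hp
    · exact h.elim (fun h => h q hq) fun h => absurd hp (h p hp')
  refine ⟨hs, ?_⟩
  rwa [← (Smash.isQuotientMap_mk y₀ z₀).isOpen_preimage, hs]

open Smash

theorem near_of_base {p : Y × Z} (h : p.1 = y₀ ∨ p.2 = z₀) : p.1 ∈ c.near ∨ p.2 ∈ d.near := by
  obtain ⟨y, z⟩ := p
  obtain rfl | rfl := h
  · exact Or.inl c.base_mem_near
  · exact Or.inr d.base_mem_near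

/-- A substitute for continuity of `rep`. If neither coordinate of `rep y` is in its `near` set,
both lie in `away`; the product of the `away` sets misses the collapsed subset, so the projection
embeds it as an open set. -/
theorem rep_mem_or_continuousAt (y : Smash y₀ z₀) :
    (∀ᶠ y' in 𝓝 y, (Smash.rep y').1 ∈ c.near ∨ (Smash.rep y').2 ∈ d.near) ∨
      ContinuousAt Smash.rep y := by
  by_cases hy : (rep y).1 ∈ c.near ∨ (rep y).2 ∈ d.near
  · left
    obtain ⟨hs, ho⟩ := isOpen_image_smashMk (y₀ := y₀) (z₀ := z₀)
      (U := {p | p.1 ∈ c.near ∨ p.2 ∈ d.near})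
      ((c.isOpen_near.preimage continuous_fst).union (d.isOpen_near.preimage continuous_snd))
      (Or.inl fun _ => near_of_base c d)
    filter_upwards [ho.mem_nhds ⟨rep y, hy, mk_rep y⟩] with y' hy'
    rw [← mk_rep y'] at hy'
    exact hs.subset hy'
  · right
    rw [not_or] at hy
    refine tendsto_def.2 fun N hN => ?_
    obtain ⟨O, hON, hO, hyO⟩ := mem_nhds_iff.1 hN
    have hU : IsOpen (O ∩ (c.away ×ˢ d.away)) := hO.inter (c.isOpen_away.prod d.isOpen_away)
    obtain ⟨hs, ho⟩ := isOpen_image_smashMk (y₀ := y₀) (z₀ := z₀) hU (Or.inr (by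
        rintro ⟨y, z⟩ (rfl | rfl) ⟨-, h⟩
        · exact c.base_notMem_away h.1
        · exact d.base_notMem_away h.2))
    filter_upwards [ho.mem_nhds ⟨rep y, ⟨hyO, (c.near_or_away _).resolve_left hy.1,
      (d.near_or_away _).resolve_left hy.2⟩, mk_rep y⟩] with y' hy'
    rw [← mk_rep y'] at hy'
    exact hON (hs.subset hy').1

end BaseContraction

/-! ### The homotopy equivalence -/

theorem PointedHomotopyEquivalent.of_forall_eq {Y Z : Type*} [TopologicalSpace Y]
    [TopologicalSpace Z] {y₀ : Y} {z₀ : Z} (hY : ∀ y, y = y₀) (hZ : ∀ z, z = z₀) :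
    PointedHomotopyEquivalent y₀ z₀ := by
  have hY' : ∀ f g : C(Y, Y), f = g := fun f g =>
    ContinuousMap.ext fun y => (hY (f y)).trans (hY (g y)).symm
  have hZ' : ∀ f g : C(Z, Z), f = g := fun f g =>
    ContinuousMap.ext fun z => (hZ (f z)).trans (hZ (g z)).symm
  refine ⟨ContinuousMap.const Y z₀, ContinuousMap.const Z y₀, rfl, rfl, ?_, ?_⟩
  · rw [hY' (ContinuousMap.comp _ _) (ContinuousMap.id Y)]
    exact ContinuousMap.HomotopicRel.refl _
  · rw [hZ' (ContinuousMap.comp _ _) (ContinuousMap.id Z)]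
    exact ContinuousMap.HomotopicRel.refl _

theorem PointedHomotopyEquivalent.of_homotopies {Y Z : Type*} [TopologicalSpace Y]
    [TopologicalSpace Z] {y₀ : Y} {z₀ : Z} {f : Y → Z} {g : Z → Y}
    {H : unitInterval × Y → Y} {H' : unitInterval × Z → Z}
    (hf : Continuous f) (hg : Continuous g) (hH : Continuous H) (hH' : Continuous H')
    (hf₀ : f y₀ = z₀) (hg₀ : g z₀ = y₀) (hH₀ : ∀ s, H (s, y₀) = y₀) (hH'₀ : ∀ s, H' (s, z₀) = z₀)
    (hH_zero : ∀ y, H (0, y) = y) (hH'_zero : ∀ z, H' (0, z) = z)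
    (hH_one : ∀ y, H (1, y) = g (f y)) (hH'_one : ∀ z, H' (1, z) = f (g z)) :
    PointedHomotopyEquivalent y₀ z₀ := by
  refine ⟨⟨f, hf⟩, ⟨g, hg⟩, hf₀, hg₀, ContinuousMap.HomotopicRel.symm ⟨?_⟩,
    ContinuousMap.HomotopicRel.symm ⟨?_⟩⟩
  · exact
      { toFun := H
        continuous_toFun := hH
        map_zero_left := hH_zero
        map_one_left := hH_one
        prop' := by rintro s _ rfl; exact hH₀ s }
  · exact
      { toFun := H'
        continuous_toFun := hH'
        map_zero_left := hH'_zero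
        map_one_left := hH'_one
        prop' := by rintro s _ rfl; exact hH'₀ s }

namespace ConfTrivialization

variable {M : Type*} [TopologicalSpace M] {k : ℕ}
  {V W : Type*} [NormedAddCommGroup V] [NormedSpace ℝ V] [FiniteDimensional ℝ V]
  [NormedAddCommGroup W] [NormedSpace ℝ W] [FiniteDimensional ℝ W]
  {X : Type*} [TopologicalSpace X]

open Smash BaseContraction

/-- A trivialization of the canonical bundle identifies `S^W ∧ D_k(M, M₀; X)` with
`D_k(M, M₀; S^V ∧ X)` up to homotopy. -/
theorem pointedHomotopyEquivalent (G : ConfTrivialization M k V W) (M₀ : Set M) {x₀ : X}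
    (hx₀ : IsNondegenerate x₀) (hk : 0 < k) [Nonempty (Conf M k)] :
    PointedHomotopyEquivalent
      (Smash.base (OnePoint.infty : OnePoint W) (AdicConstruction.base M₀ x₀ k))
      (AdicConstruction.base M₀ (Smash.base (OnePoint.infty : OnePoint V) x₀) k) := by
  have : ProperSpace V := FiniteDimensional.proper_real V
  obtain ⟨d⟩ := hx₀.nonempty_baseContraction
  let c := OnePoint.baseContraction V
  have hcc := c.continuous_toFun
  have hdc := d.continuous_toFun
  have hac := G.continuous_smashMk M₀ x₀
  let b (z : Conf M k × (Fin k → OnePoint V) × (Fin k → X)) :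
      AdicConstruction M₀ (Smash.base (OnePoint.infty : OnePoint V) x₀) k :=
    AdicConstruction.mk _ _ _ (z.1, fun i => Smash.mk _ _ (z.2.1 i, z.2.2 i))
  have hmk := (Smash.isQuotientMap_mk (OnePoint.infty : OnePoint V) x₀).continuous
  have hb : Continuous b :=
    AdicConstruction.continuous_mk.comp (by fun_prop)
  -- The equivalence itself; the parameter space `Unit` is a dummy.
  obtain ⟨Φ, hΦc, hΦ, hΦ₀⟩ := G.exists_continuous_lift (M₀ := M₀) (x₀ := x₀) (K := Unit) hk
    (fun p => b p.2) (AdicConstruction.base _ _ _) (hb.comp continuous_snd)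
    (fun _ m w a σ => AdicConstruction.mk_perm m (fun i => Smash.mk _ _ (w i, a i)) σ)
    (fun _ m w a i h => AdicConstruction.mk_eq_base i (h.imp id Smash.mk_eq_base))
  obtain ⟨H, hHc, hH, hH₀⟩ := G.exists_continuous_lift (M₀ := M₀) (x₀ := x₀)
    (K := unitInterval) hk
    (fun p => G.smashMk M₀ x₀ (p.2.1, (fun i => c.toFun (p.1, p.2.2.1 i)),
      fun i => d.toFun (p.1, p.2.2.2 i))) (Smash.base _ _)
    (hac.comp (by fun_prop))
    (fun s m w a σ => G.smashMk_perm M₀ x₀ m (fun i => c.toFun (s, w i))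
      (fun i => d.toFun (s, a i)) σ)
    (fun s m w a i h => G.smashMk_eq_base M₀ x₀ i (by
      refine h.imp id (Or.imp (fun h => ?_) fun h => ?_)
      · exact (congrArg (fun y => c.toFun (s, y)) h).trans (c.map_base s)
      · exact (congrArg (fun y => d.toFun (s, y)) h).trans (d.map_base s)))
  obtain ⟨θ, hθc, hθ⟩ := c.exists_smash_homotopy d
  have hθ₀ (s) : θ (s, Smash.base _ _) = Smash.base _ _ :=
    (hθ s _).trans (Smash.mk_eq_base (Or.inl (c.map_base s)))
  obtain ⟨H', hH'c, hH', hH'₀⟩ := AdicConstruction.exists_continuous_lift (M₀ := M₀)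
    (x₀ := Smash.base (OnePoint.infty : OnePoint V) x₀) (K := unitInterval) hk
    (fun p => AdicConstruction.mk M₀ (Smash.base (OnePoint.infty : OnePoint V) x₀) k
      (p.2.1, fun i => θ (p.1, p.2.2 i))) (AdicConstruction.base _ _ _)
    (AdicConstruction.continuous_mk.comp (by fun_prop))
    (fun s m y σ => AdicConstruction.mk_perm m (fun i => θ (s, y i)) σ)
    (fun s m y i h => AdicConstruction.mk_eq_base i (h.imp id fun h =>
      (congrArg (fun y => θ (s, y)) h).trans (hθ₀ s)))
  -- The homotopy inverse on chosen representatives, after the contractions have been run to time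
  -- `1`.
  let ψ (z : Conf M k × (Fin k → Smash (OnePoint.infty : OnePoint V) x₀)) :=
    G.smashMk M₀ x₀ (z.1, (fun i => c.toFun (1, (rep (z.2 i)).1)),
      fun i => d.toFun (1, (rep (z.2 i)).2))
  have hψ₀ (z : Conf M k × (Fin k → Smash (OnePoint.infty : OnePoint V) x₀)) (i : Fin k)
      (h : (rep (z.2 i)).1 ∈ c.near ∨ (rep (z.2 i)).2 ∈ d.near) : ψ z = Smash.base _ _ :=
    G.smashMk_eq_base M₀ x₀ i (Or.inr (h.imp (c.map_one _) (d.map_one _)))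
  have hψ (m : Conf M k) (w : Fin k → OnePoint V) (a : Fin k → X) :
      ψ (m, fun i => Smash.mk _ _ (w i, a i)) =
        G.smashMk M₀ x₀ (m, (fun i => c.toFun (1, w i)), fun i => d.toFun (1, a i)) := by
    by_cases h : ∀ i, rep (Smash.mk (OnePoint.infty : OnePoint V) x₀ (w i, a i)) = (w i, a i)
    · simp only [ψ, h]
    · obtain ⟨i, hi⟩ := not_forall.1 h
      -- Two representatives of one class differ only over the base point, where both sides are the
      -- base point.
      obtain ⟨h1, h2⟩ := (Smash.eq_or_of_mk_eq_mk (mk_rep (Smash.mk _ _ (w i, a i)))).resolve_left hi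
      rw [hψ₀ _ i (near_of_base c d h1)]
      refine (G.smashMk_eq_base M₀ x₀ i (Or.inr (h2.imp (fun h => ?_) fun h => ?_))).symm
      · exact (congrArg (fun y => c.toFun (1, y)) h).trans (c.map_base 1)
      · exact (congrArg (fun y => d.toFun (1, y)) h).trans (d.map_base 1)
  have hψc : Continuous ψ := by
    rw [continuous_iff_continuousAt]
    rintro ⟨m, y⟩
    have hev (i : Fin k) : Tendsto (fun z : Conf M k ×
        (Fin k → Smash (OnePoint.infty : OnePoint V) x₀) => z.2 i) (𝓝 (m, y)) (𝓝 (y i)) :=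
      ((continuous_apply i).comp continuous_snd).continuousAt
    -- If one coordinate stays near the base point, `ψ` is locally constant; otherwise `rep` is
    -- continuous at every coordinate.
    by_cases h : ∃ i, ∀ᶠ y' in 𝓝 (y i), (rep y').1 ∈ c.near ∨ (rep y').2 ∈ d.near
    · obtain ⟨i, hi⟩ := h
      refine (continuousAt_const (y := Smash.base _ _)).congr ?_
      filter_upwards [(hev i).eventually hi] with z hz
      exact (hψ₀ z i hz).symm
    · have hrep (i : Fin k) : ContinuousAt (fun z : Conf M k ×
          (Fin k → Smash (OnePoint.infty : OnePoint V) x₀) => rep (z.2 i)) (m, y) :=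
        ContinuousAt.comp (f := fun z : Conf M k ×
          (Fin k → Smash (OnePoint.infty : OnePoint V) x₀) => z.2 i)
          ((c.rep_mem_or_continuousAt d (y i)).resolve_left fun hi => h ⟨i, hi⟩) (hev i)
      refine hac.continuousAt.comp (continuousAt_fst.prodMk (ContinuousAt.prodMk ?_ ?_))
      · exact continuousAt_pi.2 fun i =>
          hcc.continuousAt.comp (continuousAt_const.prodMk (hrep i).fst)
      · exact continuousAt_pi.2 fun i =>
          hdc.continuousAt.comp (continuousAt_const.prodMk (hrep i).snd)
  obtain ⟨Ψ, hΨc, hΨ, hΨ₀⟩ := AdicConstruction.exists_continuous_lift (M₀ := M₀)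
    (x₀ := Smash.base (OnePoint.infty : OnePoint V) x₀) (K := Unit) hk
    (fun p => ψ p.2) (Smash.base _ _) (hψc.comp continuous_snd)
    (fun _ m y σ => G.smashMk_perm M₀ x₀ m (fun i => c.toFun (1, (rep (y i)).1))
      (fun i => d.toFun (1, (rep (y i)).2)) σ)
    (fun _ m y i h => by
      obtain h | h := h
      · exact G.smashMk_eq_base M₀ x₀ i (Or.inl h)
      · refine hψ₀ _ i ?_
        have h' : Smash.mk _ _ (rep (y i)) = Smash.mk (OnePoint.infty : OnePoint V) x₀
          (OnePoint.infty, x₀) := (mk_rep (y i)).trans h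
        obtain h' | ⟨h', -⟩ := Smash.eq_or_of_mk_eq_mk h'
        · exact near_of_base c d (Or.inl (congrArg Prod.fst h'))
        · exact near_of_base c d h')
  have hsurj := G.smashMk_surjective M₀ x₀ hk
  have hsurj' : Function.Surjective b := by
    intro e
    obtain ⟨⟨m, y⟩, rfl⟩ := AdicConstruction.mk_surjective hk e
    refine ⟨(m, (fun i => (rep (y i)).1), fun i => (rep (y i)).2), ?_⟩
    simp [b]
  have hΨb (z : Conf M k × (Fin k → OnePoint V) × (Fin k → X)) : Ψ ((), b z) =
      G.smashMk M₀ x₀ (z.1, (fun i => c.toFun (1, z.2.1 i)), fun i => d.toFun (1, z.2.2 i)) :=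
    (hΨ _ _).trans (hψ _ _ _)
  have hH'b (s : unitInterval) (z : Conf M k × (Fin k → OnePoint V) × (Fin k → X)) :
      H' (s, b z) = b (z.1, (fun i => c.toFun (s, z.2.1 i)), fun i => d.toFun (s, z.2.2 i)) := by
    refine (hH' _ _).trans ?_
    simp only [hθ, b]
  refine PointedHomotopyEquivalent.of_homotopies (f := fun y => Φ ((), y))
    (g := fun z => Ψ ((), z)) (by fun_prop) (by fun_prop) hHc hH'c (hΦ₀ _) (hΨ₀ _) hH₀ hH'₀
    ?_ ?_ ?_ ?_
  · refine hsurj.forall.2 fun z => ?_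
    simp [hH, c.map_zero, d.map_zero]
  · refine hsurj'.forall.2 fun z => ?_
    simp [hH'b, c.map_zero, d.map_zero]
  · refine hsurj.forall.2 fun z => ?_
    rw [hH, hΦ, hΨb]
  · refine hsurj'.forall.2 fun z => ?_
    rw [hH'b, hΨb, hΦ]

end ConfTrivialization

theorem corollary6p2 {M X : Type*} [TopologicalSpace M] [T2Space M] (M₀ : Set M)
    [Topology.RelCWComplex (Set.univ : Set M) M₀]
    [Topology.RelCWComplex.Finite (Set.univ : Set M)]
    [TopologicalSpace X] (x₀ : X) (hx₀ : IsNondegenerate x₀)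
    (k : ℕ) (hk : 0 < k) (hfin : ConfBundleHasFiniteOrder M k) (t : ℕ) (ht : 0 < t) :
    PointedHomotopyEquivalent
      (Susp.base (k * t * confBundleOrder M k) (AdicConstruction.base M₀ x₀ k))
      (AdicConstruction.base M₀ (Susp.base (t * confBundleOrder M k) x₀) k) := by
  -- Without configurations of `k` points, both sides reduce to their base points.
  rcases isEmpty_or_nonempty (Conf M k) with h | h
  · refine PointedHomotopyEquivalent.of_forall_eq (fun y => ?_)
      (AdicConstruction.subsingleton_of_isEmpty hk)
    obtain ⟨p, rfl⟩ := Smash.mk_surjective _ _ y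
    exact Smash.mk_eq_base (Or.inr (AdicConstruction.subsingleton_of_isEmpty hk p.2))
  -- Finite order makes the set of trivial powers nonempty, so its infimum, the order, belongs to
  -- it.
  · obtain ⟨G⟩ := nonempty_confTrivialization t (Nat.sInf_mem hfin).2
    exact G.pointedHomotopyEquivalent M₀ hx₀ hk
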